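/- Let $n\ge 1$, let ${\bm X}$ be an $n\times p$ real matrix with columns ${\bm x}_1,\dots,{\bm x}_p$, let ${\bm P}_j$ be a permutation matrix that orders ${\bm x}_j$ from least to greatest, and let $\lambda\ge 0$. Let ${\bm D}$ be the $(n-1)\times n$ matrix with $({\bm D}{\bm v})_k=v_k-v_{k+1}$. For ${\bm y}\in\mathbb R^n$, a solution of the fused lasso additive model (FLAM) with $\alpha=1$ is a minimizer $(\hat\theta_0,\hat{\bm\theta}_1,\dots,\hat{\bm\theta}_p)$ of $$\tfrac12\Big\|{\bm y}-\sum_{j=1}^p{\bm\theta}_j-\theta_0{\bm 1}\Big\|_2^2+\lambda\sum_{j=1}^p\|{\bm D}{\bm P}_j{\bm\theta}_j\|_1$$ over $\theta_0\in\mathbb R$ and ${\bm\theta}_j\in\mathbb R^n$ with ${\bm 1}^T{\bm\theta}_j=0$; its fit is $\hat{\bm y}=\sum_j\hat{\bm\theta}_j+\hat\theta_0{\bm 1}$. A knot of $\hat{\bm\theta}_j$ is a position $k$ with $({\bm P}_j\hat{\bm\theta}_j)_k\ne({\bm P}_j\hat{\bm\theta}_j)_{k+1}$, and $K$ denotes the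 total number of knots of $\hat{\bm\theta}_1,\dots,\hat{\bm\theta}_p$. Let ${\bm U}$ be the $n\times(n-1)$ matrix obtained from the upper triangular matrix of ones by centering its columns and removing the $n$th one, let ${\bm V}=[{\bm P}_1^T{\bm U}\cdots{\bm P}_p^T{\bm U}]$, and let ${\bm V}_{\mathcal A}$ consist of the columns of ${\bm V}$ at the non-zero entries $\mathcal A$ of $\hat{\bm\beta}$, where $\hat{\bm\beta}$ stacks $\hat{\bm\beta}_j={\bm D}{\bm P}_j\hat{\bm\theta}_j$, $j=1,\dots,p$. (i) If ${\bm V}_{\mathcal A}$ has full column rank for a solution at ${\bm y}$, then the degrees-of-freedom estimator satisfies $$\widehat{df}_{FLAM}=\mathrm{Tr}\big({\bm V}_{\mathcal A}[{\bm V}_{\mathcal A}^T{\bm V}_{\mathcal A}]^{-1}{\bm V}_{\mathcal A}^T\big)+1=1+K.$$ (ii) Let ${\bm y}\sim MVN({\bm\mu},\sigma^2{\bm I})$ with ${\bm\mu}\in\mathbb R^n$ and $\sigma>0$, and suppose that, almost surely, a FLAM solution for ${\bm y}$ is chosen for which ${\bm V}_{\mathcal A}$ has full column rank. Then the $\hat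 y_i$ are square integrable, $K$ is integrable, and the degrees of freedom of FLAM are $$\frac1{\sigma^2}\sum_{i=1}^n\mathrm{Cov}(y_i,\hat y_i)=\mathbb E[1+K],$$ that is, $1+K$ is an unbiased estimator of the degrees of freedom of FLAM. -/

import Mathlib

open MeasureTheory ProbabilityTheory
open scoped Matrix

noncomputable section

namespace FLAM

/-- The discrete first derivative matrix `D`, of size `(n - 1) × n`:
row `k` has `1` in column `k` and `-1` in column `k + 1`. -/
def D (n : ℕ) : Matrix (Fin (n - 1)) (Fin n) ℝ :=
  Matrix.of fun k i =>
    if i.val = k.val then 1 else if i.val = k.val + 1 then -1 else 0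

/-- The upper triangular matrix of ones. -/
def upperOnes (n : ℕ) : Matrix (Fin n) (Fin n) ℝ :=
  Matrix.of fun i k => if i ≤ k then 1 else 0

/-- Subtract from every column of `M` its mean. -/
def centerColumns {n : ℕ} (M : Matrix (Fin n) (Fin n) ℝ) : Matrix (Fin n) (Fin n) ℝ :=
  Matrix.of fun i k => M i k - (∑ l, M l k) / n

/-- The `n × (n - 1)` matrix `U`: centre the columns of the upper triangular matrix of ones and
remove the last column. -/
def U (n : ℕ) : Matrix (Fin n) (Fin (n - 1)) ℝ :=
  (centerColumns (upperOnes n)).submatrix id (Fin.castLE (Nat.sub_le n 1))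

/-- The permutation matrix with `(P τ *ᵥ v) i = v (τ i)`. -/
def P {n : ℕ} (τ : Equiv.Perm (Fin n)) : Matrix (Fin n) (Fin n) ℝ :=
  τ.permMatrix ℝ

/-- `τ` lists the observations in an order in which the feature `x` goes from least to greatest. -/
def Orders {n : ℕ} (x : Fin n → ℝ) (τ : Equiv.Perm (Fin n)) : Prop :=
  Monotone fun i => x (τ i)

/-- `V = [P₁ᵀ U ⋯ P_pᵀ U]`, with columns indexed by pairs (feature, difference). -/
def V {n p : ℕ} (τ : Fin p → Equiv.Perm (Fin n)) :
    Matrix (Fin n) (Fin p × Fin (n - 1)) ℝ :=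
  Matrix.of fun i a => ((P (τ a.1))ᵀ * U n) i a.2

/-- The differences `β_j = D P_j θ_j`, `j = 1, …, p`. -/
def differences {n p : ℕ} (τ : Fin p → Equiv.Perm (Fin n))
    (θ : Fin p → EuclideanSpace ℝ (Fin n)) (j : Fin p) : Fin (n - 1) → ℝ :=
  D n *ᵥ (P (τ j) *ᵥ (θ j).ofLp)

/-- The fit `ŷ = ∑ⱼ θ_j + θ₀ 1`. -/
def fit {n p : ℕ} (θ₀ : ℝ) (θ : Fin p → EuclideanSpace ℝ (Fin n)) : EuclideanSpace ℝ (Fin n) :=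
  ∑ j, θ j + θ₀ • WithLp.toLp 2 (fun _ : Fin n => (1 : ℝ))

/-- The FLAM objective with tuning parameters `lam`, `α` and ridge constant `ε`. -/
def objective {n p : ℕ} (τ : Fin p → Equiv.Perm (Fin n)) (α lam ε : ℝ)
    (y : EuclideanSpace ℝ (Fin n)) (θ₀ : ℝ) (θ : Fin p → EuclideanSpace ℝ (Fin n)) : ℝ :=
  1 / 2 * ‖y - fit θ₀ θ‖ ^ 2
    + α * lam * ∑ j, ∑ k, |differences τ θ j k|
    + (1 - α) * lam * ∑ j, ‖θ j‖
    + ε / 2 * ∑ j, ∑ k, differences τ θ j k ^ 2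

/-- The constraint that every fitted function has mean zero over the observations. -/
def Centered {n p : ℕ} (θ : Fin p → EuclideanSpace ℝ (Fin n)) : Prop :=
  ∀ j, ∑ i, θ j i = 0

/-- `(θ₀, θ)` is a solution of the FLAM problem for the response `y`. -/
def IsSolution {n p : ℕ} (τ : Fin p → Equiv.Perm (Fin n)) (α lam ε : ℝ)
    (y : EuclideanSpace ℝ (Fin n)) (θ₀ : ℝ) (θ : Fin p → EuclideanSpace ℝ (Fin n)) : Prop :=
  Centered θ ∧
    ∀ (η₀ : ℝ) (η : Fin p → EuclideanSpace ℝ (Fin n)), Centered η →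
      objective τ α lam ε y θ₀ θ ≤ objective τ α lam ε y η₀ η

/-- The active set `𝒜`: the positions of the non-zero differences. -/
def activeSet {n p : ℕ} (τ : Fin p → Equiv.Perm (Fin n))
    (θ : Fin p → EuclideanSpace ℝ (Fin n)) : Finset (Fin p × Fin (n - 1)) :=
  Finset.univ.filter fun a => differences τ θ a.1 a.2 ≠ 0

/-- `V_𝒜`: the columns of `V` in the active set. -/
def VA {n p : ℕ} (τ : Fin p → Equiv.Perm (Fin n))
    (θ : Fin p → EuclideanSpace ℝ (Fin n)) : Matrix (Fin n) (activeSet τ θ) ℝ :=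
  (V τ).submatrix id Subtype.val

/-- A matrix has full column rank. -/
def FullColumnRank {m ι : Type*} (M : Matrix m ι ℝ) : Prop :=
  LinearIndependent ℝ M.col

/-- The block diagonal matrix `S₂` on the active set. Since the differences vanish off the active
set, `U_{𝒜_j} β_{j𝒜_j} = U β_j`. -/
def S2 {n p : ℕ} (τ : Fin p → Equiv.Perm (Fin n))
    (θ : Fin p → EuclideanSpace ℝ (Fin n)) : Matrix (activeSet τ θ) (activeSet τ θ) ℝ :=
  Matrix.of fun a b =>
    if a.1.1 = b.1.1 then
      let Ub : Fin n → ℝ := U n *ᵥ differences τ θ a.1.1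
      let r : ℝ := ‖WithLp.toLp 2 Ub‖
      let g : Fin (n - 1) → ℝ := (U n)ᵀ *ᵥ Ub
      ((U n)ᵀ * U n) a.1.2 b.1.2 / r - g a.1.2 * g b.1.2 / r ^ 3
    else 0

/-- The estimator
`Tr(V_𝒜 [V_𝒜ᵀ V_𝒜 + (1 - α) λ S₂ + ε I]⁻¹ V_𝒜ᵀ) + 1` of the degrees of freedom. -/
def dfHat {n p : ℕ} (τ : Fin p → Equiv.Perm (Fin n)) (α lam ε : ℝ)
    (θ : Fin p → EuclideanSpace ℝ (Fin n)) : ℝ :=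
  Matrix.trace
    (VA τ θ *
      ((VA τ θ)ᵀ * VA τ θ + ((1 - α) * lam) • S2 τ θ
        + ε • (1 : Matrix (activeSet τ θ) (activeSet τ θ) ℝ))⁻¹ *
      (VA τ θ)ᵀ) + 1

/-- The knots of one fitted function: the positions at which two consecutive values differ, the
observations being listed in the order `τ` of the feature. -/
def knots {n : ℕ} (τ : Equiv.Perm (Fin n)) (θ : EuclideanSpace ℝ (Fin n)) : Set (Fin (n - 1)) :=
  {k | θ (τ ⟨k.val, by omega⟩) ≠ θ (τ ⟨k.val + 1, by omega⟩)}

/-- The total number of knots across all fitted functions. -/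
def totalKnots {n p : ℕ} (τ : Fin p → Equiv.Perm (Fin n))
    (θ : Fin p → EuclideanSpace ℝ (Fin n)) : ℕ :=
  ∑ j, (knots (τ j) (θ j)).ncard

/-- The degrees of freedom `σ⁻² ∑ᵢ Cov(yᵢ, ŷᵢ)` of the fit `Yhat` to the response `Y`. -/
def degreesOfFreedom {Ω : Type*} [MeasurableSpace Ω] {n : ℕ} (Pr : Measure Ω) (σ : ℝ)
    (Y Yhat : Ω → EuclideanSpace ℝ (Fin n)) : ℝ :=
  1 / σ ^ 2 * ∑ i, cov[fun ω => Y ω i, fun ω => Yhat ω i; Pr]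

end FLAM

end

/-! On mean-zero vectors `U` inverts the difference matrix `D`, so in the coordinates `β_j = D P_j
θ_j` FLAM with `α = 1` is a lasso with design `[1, V]`, weight `lam` on `β` and weight 0 on the
intercept. For (i), the trace is that of the projection onto the column space of `V_𝒜`, and
cyclicity reduces it to `|𝒜| = K`.

For (ii), the lasso fit is nonexpansive in `y`, hence extends to a Lipschitz map `F` on the whole
space; neither existence nor measurable choice of solutions is needed. Stein's identity turns the
covariances into `σ²` times the mean divergence of `F`. Fix a set `A` of design vectors and a sign
pattern. Where `F y` lies in the span of `A` and the residual satisfies the stationarity equations,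
increments of `F` are exactly projections of increments of `y`, so almost everywhere there the
derivative of `F` is the projection onto that span (`ae_fderiv_eq_starProjection`). There are
finitely many patterns. The trace of the projection is its rank, which is `1 + K` because `1` is
orthogonal to the columns of `V`. -/

/-! ### Integration by parts against a Gaussian weight. -/

section SteinIdentity

open scoped RealInnerProductSpace NNReal
open Filter Topology

/-- A Lipschitz function has at most linear growth. -/
lemma LipschitzWith.abs_le_mul_one_add_norm_sub {E : Type*} [SeminormedAddCommGroup E] {g : E → ℝ} {C : ℝ≥0} (hg : LipschitzWith C g)
    (m x : E) : |g x| ≤ (|g m| + C) * (1 + ‖x - m‖) := by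
  have h := hg.dist_le_mul x m
  rw [Real.dist_eq, dist_eq_norm] at h
  have h2 : |g x| ≤ |g m| + |g x - g m| := by
    have := abs_add_le (g m) (g x - g m); simpa using this
  have h3 : 0 ≤ |g m| * ‖x - m‖ := by positivity
  have h4 : (0 : ℝ) ≤ C := C.2
  nlinarith

variable {E : Type*} [NormedAddCommGroup E] [InnerProductSpace ℝ E] [FiniteDimensional ℝ E]
  [MeasurableSpace E] [BorelSpace E]

lemma integrable_exp_neg_mul_sq_norm {b : ℝ} (hb : 0 < b) :
    Integrable (fun x : E => Real.exp (-b * ‖x‖ ^ 2)) := by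
  have h := (GaussianFourier.integrable_cexp_neg_mul_sq_norm_add (b := (b : ℂ)) (by simpa using hb)
    0 (0 : E)).norm
  refine h.congr (Eventually.of_forall fun x => ?_)
  simp only [Complex.norm_exp]
  congr 1
  simp [← Complex.ofReal_pow]

/-- Half of the exponent absorbs the polynomial. The power 2 collects the linear growth of a
Lipschitz function and the linear factor from differentiating the weight. -/
lemma integrable_one_add_norm_sq_mul_exp_neg {b : ℝ} (hb : 0 < b) :
    Integrable (fun x : E => (1 + ‖x‖) ^ 2 * Real.exp (-b * ‖x‖ ^ 2)) := by
  refine ((integrable_exp_neg_mul_sq_norm (E := E) (half_pos hb)).const_mul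
    (2 + 4 / b)).mono' (by fun_prop) (Eventually.of_forall fun x => ?_)
  have h1 : b / 2 * ‖x‖ ^ 2 + 1 ≤ Real.exp (b / 2 * ‖x‖ ^ 2) := Real.add_one_le_exp _
  have h2 : (1 + ‖x‖) ^ 2 ≤ (2 + 4 / b) * Real.exp (b / 2 * ‖x‖ ^ 2) := by
    calc (1 + ‖x‖) ^ 2 ≤ 2 + 2 * ‖x‖ ^ 2 := by nlinarith [sq_nonneg (1 - ‖x‖)]
      _ ≤ (2 + 4 / b) * (b / 2 * ‖x‖ ^ 2 + 1) := by
        have : (2 + 4 / b) * (b / 2 * ‖x‖ ^ 2 + 1) =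
            2 + 2 * ‖x‖ ^ 2 + (b * ‖x‖ ^ 2 + 4 / b) := by field_simp; ring
        rw [this]
        have : 0 ≤ b * ‖x‖ ^ 2 + 4 / b := by positivity
        linarith
      _ ≤ _ := by gcongr
  rw [Real.norm_of_nonneg (by positivity)]
  calc (1 + ‖x‖) ^ 2 * Real.exp (-b * ‖x‖ ^ 2)
      ≤ (2 + 4 / b) * Real.exp (b / 2 * ‖x‖ ^ 2) * Real.exp (-b * ‖x‖ ^ 2) := by gcongr
    _ = (2 + 4 / b) * Real.exp (-(b / 2) * ‖x‖ ^ 2) := by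
        rw [mul_assoc, ← Real.exp_add]; ring_nf

/-- Integration by parts of a Lipschitz function against an isotropic Gaussian weight. -/
theorem LipschitzWith.integral_lineDeriv_mul_exp_neg {g : E → ℝ} {C : ℝ≥0}
    (hg : LipschitzWith C g) {b : ℝ} (hb : 0 < b) (m v : E) :
    Integrable (fun x => lineDeriv ℝ g x v * Real.exp (-b * ‖x - m‖ ^ 2)) ∧
    Integrable (fun x => g x * (2 * b * ⟪x - m, v⟫ * Real.exp (-b * ‖x - m‖ ^ 2))) ∧
    ∫ x, lineDeriv ℝ g x v * Real.exp (-b * ‖x - m‖ ^ 2) =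
      ∫ x, g x * (2 * b * ⟪x - m, v⟫ * Real.exp (-b * ‖x - m‖ ^ 2)) := by
  have hgc : Continuous g := hg.continuous
  have hexp : Integrable (fun x : E => Real.exp (-b * ‖x - m‖ ^ 2)) :=
    (integrable_exp_neg_mul_sq_norm hb).comp_sub_right m
  have hint : Integrable (fun x => g x * Real.exp (-b * ‖x - m‖ ^ 2)) := by
    refine (((integrable_one_add_norm_sq_mul_exp_neg (E := E) hb).comp_sub_right m).const_mul
      (|g m| + C)).mono' (by fun_prop) (Eventually.of_forall fun x => ?_)
    rw [norm_mul, Real.norm_eq_abs, Real.norm_of_nonneg (Real.exp_nonneg _), ← mul_assoc]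
    gcongr
    refine (hg.abs_le_mul_one_add_norm_sub m x).trans ?_
    gcongr
    have := norm_nonneg (x - m)
    nlinarith
  -- Translate `g` by `t • v` and differentiate at 0: the Lipschitz bound dominates the difference
  -- quotients, and `g` has a line derivative almost everywhere.
  have key1 := hasDerivAt_integral_of_dominated_loc_of_lip (μ := (volume : Measure E))
    (F := fun (t : ℝ) x => g (x + t • v) * Real.exp (-b * ‖x - m‖ ^ 2)) (x₀ := (0 : ℝ))
    (F' := fun x => lineDeriv ℝ g x v * Real.exp (-b * ‖x - m‖ ^ 2))
    (s := Set.univ) (bound := fun x => C * ‖v‖ * Real.exp (-b * ‖x - m‖ ^ 2)) univ_mem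
    (Eventually.of_forall fun t => by fun_prop) (by simpa using hint)
    ((measurable_lineDeriv hgc).aestronglyMeasurable.mul (by fun_prop))
    (Eventually.of_forall fun x => by
      refine LipschitzOnWith.of_dist_le_mul fun s _ t _ => ?_
      rw [Real.dist_eq, Real.dist_eq, ← sub_mul, abs_mul, abs_of_pos (Real.exp_pos _),
        Real.coe_nnabs,
        abs_of_nonneg (by positivity : 0 ≤ (C : ℝ) * ‖v‖ * Real.exp (-b * ‖x - m‖ ^ 2))]
      have h := hg.dist_le_mul (x + s • v) (x + t • v)
      rw [dist_add_left, dist_eq_norm (s • v), ← sub_smul, norm_smul, Real.dist_eq] at h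
      calc _ ≤ C * (‖s - t‖ * ‖v‖) * Real.exp (-b * ‖x - m‖ ^ 2) := by gcongr
        _ = _ := by rw [Real.norm_eq_abs]; ring)
    (hexp.const_mul _)
    (by
      filter_upwards [hg.ae_lineDifferentiableAt (μ := (volume : Measure E)) v] with x hx
      exact HasDerivAt.mul_const hx.hasLineDerivAt _)
  -- The translation is moved onto the smooth weight. For `|t| ≤ 1`, the inequality `‖x - m‖² ≤ 2‖x
  -- - t • v - m‖² + 2‖v‖²` costs half the exponent and the factor `exp (b‖v‖²)`.
  have key2 := hasDerivAt_integral_of_dominated_loc_of_deriv_le (μ := (volume : Measure E))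
    (F := fun (t : ℝ) x => g x * Real.exp (-b * ‖x - t • v - m‖ ^ 2)) (x₀ := (0 : ℝ))
    (F' := fun t x => g x * (2 * b * ⟪x - t • v - m, v⟫ * Real.exp (-b * ‖x - t • v - m‖ ^ 2)))
    (s := Metric.ball 0 1)
    (bound := fun x => (|g m| + C) * (2 * b * (1 + ‖v‖) * ‖v‖) * Real.exp (b * ‖v‖ ^ 2) *
      ((1 + ‖x - m‖) ^ 2 * Real.exp (-(b / 2) * ‖x - m‖ ^ 2)))
    (Metric.ball_mem_nhds _ one_pos)
    (Eventually.of_forall fun t => by fun_prop) (by simpa using hint) (by fun_prop)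
    (Eventually.of_forall fun x t ht => by
      have ht' : |t| ≤ 1 := by simpa using (mem_ball_zero_iff.1 ht).le
      have htv : ‖t • v‖ ≤ ‖v‖ := by
        rw [norm_smul, Real.norm_eq_abs]; exact mul_le_of_le_one_left (norm_nonneg _) ht'
      have e : x - t • v - m = (x - m) - t • v := by abel
      have hu : ‖x - m‖ ≤ ‖x - t • v - m‖ + ‖v‖ := by
        have := norm_le_norm_add_norm_sub' (x - m) (x - t • v - m)
        have e' : x - m - (x - t • v - m) = t • v := by abel
        rw [e'] at this; linarith
      have h1 : |⟪x - t • v - m, v⟫| ≤ (1 + ‖v‖) * (1 + ‖x - m‖) * ‖v‖ := by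
        refine (abs_real_inner_le_norm _ _).trans ?_
        gcongr
        rw [e]
        refine (_root_.norm_sub_le _ _).trans ?_
        nlinarith [norm_nonneg v, norm_nonneg (x - m)]
      have h2 : Real.exp (-b * ‖x - t • v - m‖ ^ 2) ≤
          Real.exp (b * ‖v‖ ^ 2) * Real.exp (-(b / 2) * ‖x - m‖ ^ 2) := by
        rw [← Real.exp_add]
        gcongr
        have : ‖x - m‖ ^ 2 ≤ 2 * ‖x - t • v - m‖ ^ 2 + 2 * ‖v‖ ^ 2 := by
          have h0 := norm_nonneg (x - m)
          nlinarith [sq_nonneg (‖x - t • v - m‖ - ‖v‖)]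
        nlinarith
      rw [norm_mul, norm_mul, norm_mul, Real.norm_eq_abs, Real.norm_of_nonneg (Real.exp_nonneg _),
        Real.norm_of_nonneg (by positivity : 0 ≤ 2 * b), Real.norm_eq_abs]
      calc |g x| * (2 * b * |⟪x - t • v - m, v⟫| * Real.exp (-b * ‖x - t • v - m‖ ^ 2))
          ≤ ((|g m| + C) * (1 + ‖x - m‖)) * (2 * b * ((1 + ‖v‖) * (1 + ‖x - m‖) * ‖v‖) *
            (Real.exp (b * ‖v‖ ^ 2) * Real.exp (-(b / 2) * ‖x - m‖ ^ 2))) := by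
            gcongr
            exact hg.abs_le_mul_one_add_norm_sub m x
        _ = _ := by ring)
    (((integrable_one_add_norm_sq_mul_exp_neg (E := E) (half_pos hb)).comp_sub_right m).const_mul
      _)
    (Eventually.of_forall fun x t _ => by
      have h0 : HasDerivAt (fun t : ℝ => x - t • v - m) (-v) t := by
        simpa using (((hasDerivAt_id t).smul_const v).const_sub x).sub_const m
      have h1 := ((h0.norm_sq.const_mul (-b)).exp).const_mul (g x)
      refine h1.congr_deriv ?_
      rw [inner_neg_right]
      ring)
  -- By translation invariance both parametric integrals agree, so their derivatives at 0 do too.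
  have heq : (fun t : ℝ => ∫ x, g (x + t • v) * Real.exp (-b * ‖x - m‖ ^ 2)) =
      fun t : ℝ => ∫ x, g x * Real.exp (-b * ‖x - t • v - m‖ ^ 2) := by
    funext t
    rw [← integral_add_right_eq_self (fun x => g x * Real.exp (-b * ‖x - t • v - m‖ ^ 2)) (t • v)]
    simp
  refine ⟨key1.1, by simpa using key2.1, ?_⟩
  have h := (heq ▸ key1.2).unique key2.2
  simpa using h

end SteinIdentity

/-! ### The isotropic Gaussian density and Stein's identity. -/

section GaussianDensity

open scoped RealInnerProductSpace NNReal
open Filter Topology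

variable {ι : Type*} [Fintype ι] [DecidableEq ι]

/-- The Gaussian measure with covariance `σ² I` has a density with respect to Lebesgue measure. -/
theorem ProbabilityTheory.multivariateGaussian_sq_smul_one_eq_withDensity
    (μ : EuclideanSpace ℝ ι) {σ : ℝ} (hσ : 0 < σ) :
    ∃ c : ℝ, 0 < c ∧ multivariateGaussian μ (σ ^ 2 • (1 : Matrix ι ι ℝ)) =
      volume.withDensity
        (fun x => ENNReal.ofReal (c * Real.exp (-(1 / (2 * σ ^ 2)) * ‖x - μ‖ ^ 2))) := by
  set b : ℝ := 1 / (2 * σ ^ 2) with hbdef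
  have hb : 0 < b := by positivity
  have hint := integrable_exp_neg_mul_sq_norm (E := EuclideanSpace ℝ ι) hb
  set I : ℝ := ∫ x : EuclideanSpace ℝ ι, Real.exp (-b * ‖x‖ ^ 2) with hI
  have hIpos : 0 < I := integral_exp_pos hint
  refine ⟨I⁻¹, inv_pos.2 hIpos, ?_⟩
  have hden : Integrable (fun x : EuclideanSpace ℝ ι => I⁻¹ * Real.exp (-b * ‖x - μ‖ ^ 2)) :=
    (hint.comp_sub_right μ).const_mul _
  have : IsFiniteMeasure ((volume : Measure (EuclideanSpace ℝ ι)).withDensity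
      (fun x => ENNReal.ofReal (I⁻¹ * Real.exp (-b * ‖x - μ‖ ^ 2)))) :=
    isFiniteMeasure_withDensity_ofReal hden.2
  -- Both measures are finite, so comparing characteristic functions suffices; the normalizing
  -- constant `I⁻¹` never has to be evaluated.
  refine Measure.ext_of_charFun ?_
  funext t
  rw [charFun_multivariateGaussian (Matrix.PosSemidef.one.smul (sq_nonneg σ)), charFun_apply,
    integral_withDensity_eq_integral_toReal_smul (by fun_prop) (by simp)]
  have hI' : ∫ x : EuclideanSpace ℝ ι, Complex.exp (-(b : ℂ) * ‖x‖ ^ 2) = I := by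
    rw [hI, ← integral_complex_ofReal]
    simp
  have h1 := GaussianFourier.integral_cexp_neg_mul_sq_norm_add (b := (b : ℂ)) (by simpa using hb)
    Complex.I t
  have h0 := GaussianFourier.integral_cexp_neg_mul_sq_norm (V := EuclideanSpace ℝ ι) (b := (b : ℂ))
    (by simpa using hb)
  rw [← h0, hI'] at h1
  have h2 : ∀ x : EuclideanSpace ℝ ι, (ENNReal.ofReal (I⁻¹ * Real.exp (-b * ‖x - μ‖ ^ 2))).toReal •
      Complex.exp (⟪x, t⟫ * Complex.I) = ((I⁻¹ : ℝ) : ℂ) * Complex.exp (⟪t, μ⟫ * Complex.I) *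
        Complex.exp (-(b : ℂ) * ‖x - μ‖ ^ 2 + Complex.I * ⟪t, x - μ⟫) := by
    intro x
    rw [ENNReal.toReal_ofReal (by positivity), Complex.real_smul, mul_assoc, ← Complex.exp_add]
    push_cast
    rw [mul_assoc, ← Complex.exp_add]
    congr 2
    rw [inner_sub_right, real_inner_comm x t]
    push_cast
    ring
  simp_rw [h2]
  rw [integral_const_mul, integral_sub_right_eq_self
    (fun x : EuclideanSpace ℝ ι => Complex.exp (-(b : ℂ) * ‖x‖ ^ 2 + Complex.I * ⟪t, x⟫)), h1]
  have hI0 : (I : ℂ) ≠ 0 := by exact_mod_cast hIpos.ne'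
  have h3 : ((t.ofLp ⬝ᵥ (σ ^ 2 • (1 : Matrix ι ι ℝ)) *ᵥ t.ofLp : ℝ) : ℂ) =
      (σ : ℂ) ^ 2 * (‖t‖ : ℂ) ^ 2 := by
    rw [← Complex.ofReal_pow ‖t‖, EuclideanSpace.real_norm_sq_eq]
    simp [Matrix.smul_mulVec, dotProduct, pow_two, Finset.mul_sum]
    exact Finset.sum_congr rfl fun i _ => by ring
  rw [h3, Complex.ofReal_inv]
  rw [show (I : ℂ)⁻¹ * Complex.exp (⟪t, μ⟫ * Complex.I) *
    ((I : ℂ) * Complex.exp (Complex.I ^ 2 * ‖t‖ ^ 2 / (4 * b))) =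
    Complex.exp (⟪t, μ⟫ * Complex.I) * Complex.exp (Complex.I ^ 2 * ‖t‖ ^ 2 / (4 * b)) by
      field_simp, ← Complex.exp_add]
  congr 1
  rw [hbdef, Complex.I_sq]
  have : (σ : ℂ) ≠ 0 := by exact_mod_cast hσ.ne'
  push_cast
  field_simp
  ring

lemma ProbabilityTheory.multivariateGaussian_sq_smul_one_absolutelyContinuous
    (μ : EuclideanSpace ℝ ι) {σ : ℝ} (hσ : 0 < σ) :
    multivariateGaussian μ (σ ^ 2 • (1 : Matrix ι ι ℝ)) ≪ volume := by
  obtain ⟨c, -, h⟩ := multivariateGaussian_sq_smul_one_eq_withDensity μ hσ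
  rw [h]
  exact withDensity_absolutelyContinuous _ _

/-- A Lipschitz function is square integrable for a Gaussian measure. -/
lemma LipschitzWith.memLp_two_multivariateGaussian {g : EuclideanSpace ℝ ι → ℝ} {C : ℝ≥0}
    (hg : LipschitzWith C g) (μ : EuclideanSpace ℝ ι) (S : Matrix ι ι ℝ) :
    MemLp g 2 (multivariateGaussian μ S) := by
  have h0 : MemLp (fun x : EuclideanSpace ℝ ι => ‖x‖) 2 (multivariateGaussian μ S) :=
    (IsGaussian.memLp_two_id (μ := multivariateGaussian μ S)).norm
  have hc : MemLp (fun _ : EuclideanSpace ℝ ι => (1 : ℝ)) 2 (multivariateGaussian μ S) :=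
    memLp_const 1
  have h1 : MemLp (fun x : EuclideanSpace ℝ ι => (|g 0| + C) * (1 + ‖x‖)) 2
      (multivariateGaussian μ S) :=
    (hc.add h0).const_mul (|g 0| + C)
  refine h1.mono hg.continuous.aestronglyMeasurable (Eventually.of_forall fun x => ?_)
  have := hg.abs_le_mul_one_add_norm_sub 0 x
  rw [sub_zero] at this
  exact this.trans (le_abs_self _)

/-- **Stein's identity** for a Lipschitz function of a Gaussian vector with covariance `σ² I`. -/
theorem LipschitzWith.covariance_multivariateGaussian {g : EuclideanSpace ℝ ι → ℝ} {C : ℝ≥0}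
    (hg : LipschitzWith C g) (μ : EuclideanSpace ℝ ι) {σ : ℝ} (hσ : 0 < σ) (i : ι) :
    Integrable (fun x => lineDeriv ℝ g x (EuclideanSpace.single i 1))
      (multivariateGaussian μ (σ ^ 2 • (1 : Matrix ι ι ℝ))) ∧
    cov[fun x => x i, g; multivariateGaussian μ (σ ^ 2 • (1 : Matrix ι ι ℝ))] =
      σ ^ 2 * ∫ x, lineDeriv ℝ g x (EuclideanSpace.single i 1)
        ∂(multivariateGaussian μ (σ ^ 2 • (1 : Matrix ι ι ℝ))) := by
  have hmean : ∫ x, x i ∂(multivariateGaussian μ (σ ^ 2 • (1 : Matrix ι ι ℝ))) = μ i := by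
    have h := (EuclideanSpace.proj (𝕜 := ℝ) i).integral_comp_id_comm (IsGaussian.integrable_id
      (μ := multivariateGaussian μ (σ ^ 2 • (1 : Matrix ι ι ℝ))))
    simpa using h
  rw [covariance, hmean]
  set a := ∫ x, g x ∂(multivariateGaussian μ (σ ^ 2 • (1 : Matrix ι ι ℝ)))
  -- Centering `g` at its mean gives the covariance integrand and leaves line derivatives unchanged.
  have hg' : LipschitzWith C (fun x => g x - a) := fun x y => by
    simpa [edist_dist, Real.dist_eq] using hg x y
  obtain ⟨c, hc, h⟩ := multivariateGaussian_sq_smul_one_eq_withDensity μ hσ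
  obtain ⟨i1, i2, e⟩ := hg'.integral_lineDeriv_mul_exp_neg
    (by positivity : 0 < 1 / (2 * σ ^ 2)) μ (EuclideanSpace.single i 1)
  have hl : ∀ x v, lineDeriv ℝ (fun x => g x - a) x v = lineDeriv ℝ g x v := fun x v => by
    simp [lineDeriv]
  simp_rw [hl] at i1 i2 e
  rw [h]
  constructor
  · rw [integrable_withDensity_iff_integrable_smul' (by fun_prop) (by simp)]
    refine (i1.const_mul c).congr (Eventually.of_forall fun x => ?_)
    simp only [smul_eq_mul]
    rw [ENNReal.toReal_ofReal (by positivity)]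
    ring
  · rw [integral_withDensity_eq_integral_toReal_smul (by fun_prop) (by simp),
      integral_withDensity_eq_integral_toReal_smul (by fun_prop) (by simp)]
    have hd : ∀ x : EuclideanSpace ℝ ι,
        (ENNReal.ofReal (c * Real.exp (-(1 / (2 * σ ^ 2)) * ‖x - μ‖ ^ 2))).toReal =
        c * Real.exp (-(1 / (2 * σ ^ 2)) * ‖x - μ‖ ^ 2) :=
      fun x => ENNReal.toReal_ofReal (by positivity)
    -- The factor `σ ^ 2` arises because `2b = 1 / σ ^ 2` for `b = 1 / (2 * σ ^ 2)`.
    have e1 : ∀ x : EuclideanSpace ℝ ι,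
        (c * Real.exp (-(1 / (2 * σ ^ 2)) * ‖x - μ‖ ^ 2)) • ((x i - μ i) * (g x - a)) =
        (c * σ ^ 2) * ((g x - a) * (2 * (1 / (2 * σ ^ 2)) *
          ⟪x - μ, EuclideanSpace.single i (1 : ℝ)⟫ *
          Real.exp (-(1 / (2 * σ ^ 2)) * ‖x - μ‖ ^ 2))) := fun x => by
      rw [EuclideanSpace.inner_single_right]
      simp
      field_simp
    have e2 : ∀ x : EuclideanSpace ℝ ι, (c * Real.exp (-(1 / (2 * σ ^ 2)) * ‖x - μ‖ ^ 2)) •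
        lineDeriv ℝ g x (EuclideanSpace.single i 1) = c *
        (lineDeriv ℝ g x (EuclideanSpace.single i 1) *
          Real.exp (-(1 / (2 * σ ^ 2)) * ‖x - μ‖ ^ 2)) := fun x => by
      rw [smul_eq_mul]; ring
    simp_rw [hd, e1, e2]
    rw [integral_const_mul, integral_const_mul, e]
    ring

end GaussianDensity

/-! ### Weighted lasso: optimality, stability and derivative of the fit. -/

section WeightedLasso

open scoped RealInnerProductSpace NNReal
open Filter Topology

variable {κ : Type*} [Fintype κ] {E : Type*} [NormedAddCommGroup E] [InnerProductSpace ℝ E]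

/-- The lasso objective with design vectors `v` and penalty weights `w`. -/
noncomputable def lassoObjective (v : κ → E) (w : κ → ℝ) (y : E) (b : κ → ℝ) : ℝ :=
  1 / 2 * ‖y - ∑ a, b a • v a‖ ^ 2 + ∑ a, w a * |b a|

/-- `b` minimizes the lasso objective for the response `y`. -/
def IsLassoSolution (v : κ → E) (w : κ → ℝ) (y : E) (b : κ → ℝ) : Prop :=
  ∀ c, lassoObjective v w y b ≤ lassoObjective v w y c

namespace IsLassoSolution

variable {v : κ → E} {w : κ → ℝ} {y y' : E} {b b' : κ → ℝ}

/-- The variational inequality characterizing lasso solutions. -/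
lemma inner_residual_le (hw : ∀ a, 0 ≤ w a) (h : IsLassoSolution v w y b) (c : κ → ℝ) :
    ⟪y - ∑ a, b a • v a, ∑ a, c a • v a - ∑ a, b a • v a⟫ ≤
      ∑ a, w a * |c a| - ∑ a, w a * |b a| := by
  set r := y - ∑ a, b a • v a with hr
  set d := ∑ a, c a • v a - ∑ a, b a • v a with hd
  -- Compare `b` with the point a fraction `t` of the way to `c`. Convexity bounds the penalty;
  -- dividing by `t` leaves an error `t / 2 * ‖d‖ ^ 2` that vanishes as `t → 0`.
  have key : ∀ t : ℝ, 0 < t → t ≤ 1 →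
      ⟪r, d⟫ ≤ t / 2 * ‖d‖ ^ 2 + (∑ a, w a * |c a| - ∑ a, w a * |b a|) := by
    intro t ht0 ht1
    have h1 := h (fun a => b a + t * (c a - b a))
    have h2 : y - ∑ a, (b a + t * (c a - b a)) • v a = r - t • d := by
      rw [hr, hd, smul_sub, Finset.smul_sum, Finset.smul_sum, ← Finset.sum_sub_distrib]
      simp_rw [add_smul, Finset.sum_add_distrib, mul_sub, sub_smul, mul_smul]
      abel
    have h3 : ∑ a, w a * |b a + t * (c a - b a)| ≤
        (1 - t) * ∑ a, w a * |b a| + t * ∑ a, w a * |c a| := by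
      rw [Finset.mul_sum, Finset.mul_sum, ← Finset.sum_add_distrib]
      refine Finset.sum_le_sum fun a _ => ?_
      have : |b a + t * (c a - b a)| ≤ (1 - t) * |b a| + t * |c a| := by
        calc |b a + t * (c a - b a)| = |(1 - t) * b a + t * c a| := by ring_nf
          _ ≤ |(1 - t) * b a| + |t * c a| := abs_add_le _ _
          _ = _ := by rw [abs_mul, abs_mul, abs_of_pos ht0, abs_of_nonneg (by linarith)]
      nlinarith [mul_le_mul_of_nonneg_left this (hw a)]
    rw [lassoObjective, lassoObjective, h2, ← hr, norm_sub_sq_real r (t • d), inner_smul_right, norm_smul,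
      Real.norm_of_nonneg ht0.le] at h1
    have h4 : t * ⟪r, d⟫ ≤
        t * (t / 2 * ‖d‖ ^ 2 + (∑ a, w a * |c a| - ∑ a, w a * |b a|)) := by nlinarith
    exact le_of_mul_le_mul_left h4 ht0
  have hlim : Tendsto (fun t : ℝ => t / 2 * ‖d‖ ^ 2 + (∑ a, w a * |c a| - ∑ a, w a * |b a|))
      (𝓝[>] 0) (𝓝 (0 / 2 * ‖d‖ ^ 2 + (∑ a, w a * |c a| - ∑ a, w a * |b a|))) :=
    Tendsto.mono_left (Continuous.tendsto (by fun_prop) 0) nhdsWithin_le_nhds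
  have := ge_of_tendsto hlim (b := ⟪r, d⟫) (by
    filter_upwards [Ioc_mem_nhdsGT one_pos] with t ht using key t ht.1 ht.2)
  simpa using this

/-- The lasso fit is a nonexpansive function of the response. -/
lemma norm_fit_sub_le (hw : ∀ a, 0 ≤ w a) (h : IsLassoSolution v w y b)
    (h' : IsLassoSolution v w y' b') :
    ‖∑ a, b a • v a - ∑ a, b' a • v a‖ ≤ ‖y - y'‖ := by
  have h1 := h.inner_residual_le hw b'
  have h2 := h'.inner_residual_le hw b
  set f := ∑ a, b a • v a
  set f' := ∑ a, b' a • v a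
  -- Testing each solution against the other and adding cancels the penalties.
  have h3 : ⟪f - f', f - f'⟫ ≤ ⟪y - y', f - f'⟫ := by
    have e : ⟪y - f, f' - f⟫ + ⟪y' - f', f - f'⟫ = ⟪f - f', f - f'⟫ - ⟪y - y', f - f'⟫ := by
      rw [← neg_sub f f', inner_neg_right, ← sub_eq_neg_add, ← inner_sub_left, ← inner_sub_left]
      congr 1
      abel
    linarith
  rw [real_inner_self_eq_norm_sq] at h3
  have h4 := h3.trans (real_inner_le_norm _ _)
  rcases (norm_nonneg (f - f')).eq_or_lt with h0 | h0
  · rw [← h0]; positivity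
  · rw [pow_two] at h4
    exact le_of_mul_le_mul_right h4 h0

/-- The stationarity condition at active or unpenalized coordinates. -/
lemma inner_residual_eq [DecidableEq κ] (hw : ∀ a, 0 ≤ w a) (h : IsLassoSolution v w y b) {a : κ}
    (ha : b a ≠ 0 ∨ w a = 0) :
    ⟪y - ∑ a, b a • v a, v a⟫ = w a * (SignType.sign (b a) : ℝ) := by
  have key : ∀ t : ℝ, t * ⟪y - ∑ a, b a • v a, v a⟫ ≤ w a * |b a + t| - w a * |b a| := by
    intro t
    have h1 := h.inner_residual_le hw (b + Pi.single a t)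
    rw [← Finset.sum_sub_distrib, ← Finset.sum_sub_distrib] at h1
    simp_rw [← sub_smul, Pi.add_apply, add_sub_cancel_left] at h1
    have e1 : ∑ x, (Pi.single a t : κ → ℝ) x • v x = t • v a := by
      rw [Finset.sum_eq_single a] <;> simp +contextual
    have e2 : ∑ x, (w x * |b x + (Pi.single a t : κ → ℝ) x| - w x * |b x|) =
        w a * |b a + t| - w a * |b a| := by
      rw [Finset.sum_eq_single a] <;> simp +contextual
    rwa [e1, e2, inner_smul_right] at h1
  rcases eq_or_ne (w a) 0 with h0 | h0
  · have h1 := key 1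
    have h2 := key (-1)
    rw [h0] at h1 h2 ⊢
    linarith
  · have hb : b a ≠ 0 := ha.resolve_right h0
    -- Doubling the coordinate and setting it to zero give opposite inequalities.
    have h1 := key (b a)
    have h2 := key (-b a)
    rw [← two_mul, abs_mul, abs_two] at h1
    rw [add_neg_cancel, abs_zero] at h2
    have h3 : b a * ⟪y - ∑ a, b a • v a, v a⟫ = b a * (w a * (SignType.sign (b a) : ℝ)) := by
      rw [show b a * (w a * (SignType.sign (b a) : ℝ)) = w a * ((SignType.sign (b a) : ℝ) * b a) by
        ring, sign_mul_self]
      linarith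
    exact mul_left_cancel₀ hb h3

lemma _root_.sum_smul_mem_span_image {v : κ → E} {b : κ → ℝ} {A : Set κ}
    (hA : ∀ a, b a ≠ 0 → a ∈ A) : ∑ a, b a • v a ∈ Submodule.span ℝ (v '' A) := by
  refine Submodule.sum_mem _ fun a _ => ?_
  by_cases h : b a = 0
  · simp [h]
  · exact Submodule.smul_mem _ _ (Submodule.subset_span ⟨a, hA a h, rfl⟩)

end IsLassoSolution

variable [FiniteDimensional ℝ E] [MeasurableSpace E] [BorelSpace E]

omit [Fintype κ] in
/-- Almost everywhere on the set where the fit `F` lies in the span of the design vectors indexed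
by `A` and the residual has prescribed inner products with these, the derivative of `F` is the
orthogonal projection onto the span. -/
lemma ae_fderiv_eq_starProjection {F : E → E} {C : ℝ≥0} (hF : LipschitzWith C F) (v : κ → E)
    (A : Set κ) (u : κ → ℝ) :
    ∀ᵐ y ∂(volume : Measure E), (∀ a ∈ A, ⟪y - F y, v a⟫ = u a) →
      F y ∈ Submodule.span ℝ (v '' A) →
      fderiv ℝ F y = (Submodule.span ℝ (v '' A)).starProjection := by
  set W := Submodule.span ℝ (v '' A) with hW
  set T : Set E := {y | (∀ a ∈ A, ⟪y - F y, v a⟫ = u a) ∧ F y ∈ W} with hT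
  have hFc := hF.continuous
  have hTm : IsClosed T := by
    have : T = (⋂ a ∈ A, {y | ⟪y - F y, v a⟫ = u a}) ∩ F ⁻¹' W := by ext y; simp [hT]
    rw [this]
    refine IsClosed.inter (isClosed_biInter fun a _ => isClosed_eq (by fun_prop) (by fun_prop)) ?_
    exact W.closed_of_finiteDimensional.preimage hFc
  obtain ⟨D, hDm, hDd, hDae⟩ : ∃ D : Set E, MeasurableSet D ∧
      (∀ y ∈ D, DifferentiableAt ℝ F y) ∧ ∀ᵐ y ∂(volume : Measure E), y ∈ D :=
    ⟨{y | DifferentiableAt ℝ F y}, measurableSet_of_differentiableAt ℝ F, fun _ h => h,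
      hF.ae_differentiableAt⟩
  -- Increments of `F` on `T` lie in `W` and increments of the residual are orthogonal to `W`, so
  -- the linear approximation has error constant 0.
  have happ : ApproximatesLinearOn F W.starProjection (T ∩ D) 0 := by
    rintro x ⟨⟨hx1, hx2⟩, -⟩ y ⟨⟨hy1, hy2⟩, -⟩
    have : W.starProjection (x - y) = F x - F y := by
      refine Submodule.eq_starProjection_of_mem_of_inner_eq_zero (W.sub_mem hx2 hy2) ?_
      intro z hz
      induction hz using Submodule.span_induction with
      | mem z hz =>
        obtain ⟨a, ha, rfl⟩ := hz
        rw [show x - y - (F x - F y) = (x - F x) - (y - F y) by abel, inner_sub_left, hx1 a ha,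
          hy1 a ha, sub_self]
      | zero => simp
      | add z z' _ _ h h' => rw [inner_add_right, h, h', add_zero]
      | smul c z _ h => rw [inner_smul_right, h, mul_zero]
    simp [this]
  have h := happ.norm_fderiv_sub_le volume (hTm.measurableSet.inter hDm) (fderiv ℝ F)
    fun x hx => (hDd x hx.2).hasFDerivAt.hasFDerivWithinAt
  rw [ae_restrict_iff' (hTm.measurableSet.inter hDm)] at h
  filter_upwards [h, hDae] with y hy hyD h1 h2
  have := hy ⟨⟨h1, h2⟩, hyD⟩
  rw [nonpos_iff_eq_zero, nnnorm_eq_zero, sub_eq_zero] at this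
  exact this

/-- The lasso fit extends to a Lipschitz function of the response. Almost everywhere its derivative
is the orthogonal projection onto the span of the active and any unpenalized design vectors, for
every solution. -/
theorem exists_lipschitzWith_lasso_fit (v : κ → E) {w : κ → ℝ} (hw : ∀ a, 0 ≤ w a) :
    ∃ (F : E → E) (C : ℝ≥0), LipschitzWith C F ∧
      (∀ y b, IsLassoSolution v w y b → F y = ∑ a, b a • v a) ∧
      ∀ᵐ y ∂(volume : Measure E), ∀ (b : κ → ℝ) (A : Set κ), IsLassoSolution v w y b →
        (∀ a, b a ≠ 0 → a ∈ A) → (∀ a ∈ A, b a ≠ 0 ∨ w a = 0) →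
        fderiv ℝ F y = (Submodule.span ℝ (v '' A)).starProjection := by
  classical
  set S : Set E := {y | ∃ b, IsLassoSolution v w y b} with hS
  choose! β hβ using (fun y (hy : y ∈ S) => hy : ∀ y ∈ S, ∃ b, IsLassoSolution v w y b)
  have hL : LipschitzOnWith 1 (fun y => ∑ a, β y a • v a) S :=
    LipschitzOnWith.of_dist_le_mul fun y hy y' hy' => by
      simpa [dist_eq_norm] using (hβ y hy).norm_fit_sub_le hw (hβ y' hy')
  -- The extension may enlarge the Lipschitz constant; any finite constant will do.
  obtain ⟨F, hF, hFS⟩ := hL.extend_finite_dimension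
  have hfit : ∀ y b, IsLassoSolution v w y b → F y = ∑ a, b a • v a := fun y b h => by
    rw [← hFS ⟨b, h⟩, ← sub_eq_zero, ← norm_le_zero_iff]
    simpa using (hβ y ⟨b, h⟩).norm_fit_sub_le hw h
  refine ⟨F, _, hF, hfit, ?_⟩
  -- The conditions involve only `F`, not the chosen coefficients, and the finitely many pairs `(A,
  -- s)` share one null set.
  have hall : ∀ᵐ y ∂(volume : Measure E), ∀ (A : Set κ) (s : κ → SignType),
      (∀ a ∈ A, ⟪y - F y, v a⟫ = w a * (s a : ℝ)) → F y ∈ Submodule.span ℝ (v '' A) →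
      fderiv ℝ F y = (Submodule.span ℝ (v '' A)).starProjection := by
    rw [ae_all_iff]
    intro A
    rw [ae_all_iff]
    intro s
    exact ae_fderiv_eq_starProjection hF v A _
  filter_upwards [hall] with y hy b A hb hA hA'
  refine hy A (fun a => SignType.sign (b a)) (fun a ha => ?_) ?_
  · rw [hfit y b hb]
    exact hb.inner_residual_eq hw (hA' a ha)
  · rw [hfit y b hb]
    exact sum_smul_mem_span_image hA

end WeightedLasso

/-! ### FLAM as a lasso, and its degrees of freedom. -/

noncomputable section

namespace FLAM

open scoped RealInnerProductSpace NNReal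
open Filter Topology

variable {n p : ℕ}

lemma D_mulVec (v : Fin n → ℝ) (k : Fin (n - 1)) :
    (D n *ᵥ v) k = v ⟨k.val, by omega⟩ - v ⟨k.val + 1, by omega⟩ := by
  have hk := k.2
  have h : ∀ i : Fin n, D n k i * v i =
      (if i = ⟨k.val, by omega⟩ then v i else 0) -
        (if i = ⟨k.val + 1, by omega⟩ then v i else 0) := by
    intro i
    simp only [D, Matrix.of_apply, Fin.ext_iff]
    split_ifs <;> first | omega | ring
  rw [Matrix.mulVec, dotProduct]
  simp_rw [h, Finset.sum_sub_distrib, Finset.sum_ite_eq', Finset.mem_univ, if_true]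

lemma sum_U (hn : 1 ≤ n) (k : Fin (n - 1)) : ∑ i, U n i k = 0 := by
  have : (n : ℝ) ≠ 0 := by positivity
  simp only [U, centerColumns, Matrix.submatrix_apply, Matrix.of_apply, id_eq,
    Finset.sum_sub_distrib, Finset.sum_const, Finset.card_univ, Fintype.card_fin, nsmul_eq_mul]
  field_simp
  simp

/-- Centering shifts a column by a constant, which differences ignore, and the `l`th step column
drops only between rows `l` and `l + 1`. -/
lemma D_mul_U : D n * U n = 1 := by
  ext k l
  have h : (D n * U n) k l = (D n *ᵥ fun i => U n i l) k := rfl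
  rw [h, D_mulVec, Matrix.one_apply]
  simp only [U, centerColumns, upperOnes, Matrix.submatrix_apply, Matrix.of_apply, id_eq,
    Fin.le_def, Fin.ext_iff, Fin.val_castLE, sub_sub_sub_cancel_right]
  split_ifs <;> first | omega | norm_num

/-- A vector with mean zero is determined by its differences. -/
lemma eq_zero_of_D_mulVec_eq_zero {v : Fin n → ℝ} (hD : D n *ᵥ v = 0) (hv : ∑ i, v i = 0) :
    v = 0 := by
  rcases Nat.eq_zero_or_pos n with rfl | hn
  · exact Subsingleton.elim _ _
  have hconst : ∀ (m : ℕ) (hm : m < n), v ⟨m, hm⟩ = v ⟨0, hn⟩ := by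
    intro m
    induction m with
    | zero => exact fun _ => rfl
    | succ m ih =>
      intro hm
      have h := congrFun hD ⟨m, by omega⟩
      rw [D_mulVec, Pi.zero_apply, sub_eq_zero] at h
      exact h.symm.trans (ih _)
  have h0 : v = fun _ => v ⟨0, hn⟩ := funext fun i => hconst i i.2
  rw [h0, Finset.sum_const, Finset.card_univ, Fintype.card_fin, nsmul_eq_mul] at hv
  have h1 : v ⟨0, hn⟩ = 0 := (mul_eq_zero.1 hv).resolve_left (by positivity)
  rw [h0, h1]
  rfl

lemma sum_U_mulVec (hn : 1 ≤ n) (b : Fin (n - 1) → ℝ) : ∑ i, (U n *ᵥ b) i = 0 := by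
  simp only [Matrix.mulVec, dotProduct]
  rw [Finset.sum_comm]
  simp [← Finset.sum_mul, sum_U hn]

/-- A vector with mean zero is recovered from its differences by `U`. -/
lemma U_mulVec_D_mulVec (hn : 1 ≤ n) {v : Fin n → ℝ} (hv : ∑ i, v i = 0) :
    U n *ᵥ (D n *ᵥ v) = v := by
  refine sub_eq_zero.1 (eq_zero_of_D_mulVec_eq_zero ?_ ?_)
  · rw [Matrix.mulVec_sub, Matrix.mulVec_mulVec, D_mul_U, Matrix.one_mulVec, sub_self]
  · simp only [Pi.sub_apply, Finset.sum_sub_distrib, hv, sum_U_mulVec hn, sub_self]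

lemma P_mulVec (τ : Equiv.Perm (Fin n)) (v : Fin n → ℝ) : P τ *ᵥ v = v ∘ τ :=
  Matrix.permMatrix_mulVec τ

lemma V_apply (τ : Fin p → Equiv.Perm (Fin n)) (i : Fin n) (a : Fin p × Fin (n - 1)) :
    V τ i a = U n ((τ a.1).symm i) a.2 := by
  simp only [V, P, Matrix.of_apply, Matrix.mul_apply, Matrix.transpose_apply,
    Equiv.Perm.permMatrix, PEquiv.toMatrix_apply, Equiv.toPEquiv_apply, Option.mem_def,
    Option.some.injEq, ite_mul, one_mul, zero_mul]
  rw [Finset.sum_eq_single ((τ a.1).symm i)]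
  · simp
  · intro j _ hj
    rw [if_neg]
    rintro rfl
    simp at hj
  · simp

/-- The design vectors of the FLAM problem as a lasso problem: the intercept and the columns
of `V`. -/
def design (τ : Fin p → Equiv.Perm (Fin n)) :
    Option (Fin p × Fin (n - 1)) → EuclideanSpace ℝ (Fin n)
  | none => WithLp.toLp 2 fun _ => 1
  | some a => WithLp.toLp 2 ((V τ).col a)

/-- The penalty weights of the FLAM problem as a lasso problem: the intercept is unpenalized. -/
def penaltyWeight (n p : ℕ) (lam : ℝ) : Option (Fin p × Fin (n - 1)) → ℝ
  | none => 0
  | some _ => lam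

/-- The lasso coefficients of a FLAM candidate. -/
def coefficients (τ : Fin p → Equiv.Perm (Fin n)) (θ₀ : ℝ) (θ : Fin p → EuclideanSpace ℝ (Fin n)) :
    Option (Fin p × Fin (n - 1)) → ℝ
  | none => θ₀
  | some a => differences τ θ a.1 a.2

/-- The FLAM candidate with prescribed differences. -/
def ofDifferences (τ : Fin p → Equiv.Perm (Fin n)) (c : Fin p × Fin (n - 1) → ℝ) (j : Fin p) :
    EuclideanSpace ℝ (Fin n) :=
  ∑ k, c (j, k) • design τ (some (j, k))

lemma ofDifferences_apply (τ : Fin p → Equiv.Perm (Fin n)) (c : Fin p × Fin (n - 1) → ℝ)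
    (j : Fin p) (i : Fin n) :
    ofDifferences τ c j i = (U n *ᵥ fun k => c (j, k)) ((τ j).symm i) := by
  simp [ofDifferences, design, Matrix.mulVec, dotProduct, V_apply, mul_comm]

lemma centered_ofDifferences (hn : 1 ≤ n) (τ : Fin p → Equiv.Perm (Fin n))
    (c : Fin p × Fin (n - 1) → ℝ) : Centered (ofDifferences τ c) := fun j => by
  simp_rw [ofDifferences_apply]
  rw [Equiv.sum_comp (τ j).symm (U n *ᵥ fun k => c (j, k)), sum_U_mulVec hn]

lemma differences_ofDifferences (τ : Fin p → Equiv.Perm (Fin n))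
    (c : Fin p × Fin (n - 1) → ℝ) (j : Fin p) :
    differences τ (ofDifferences τ c) j = fun k => c (j, k) := by
  have h : (ofDifferences τ c j).ofLp ∘ τ j = U n *ᵥ fun k => c (j, k) := by
    funext i
    simp [ofDifferences_apply]
  rw [differences, P_mulVec, h, Matrix.mulVec_mulVec, D_mul_U, Matrix.one_mulVec]

/-- Together with `differences_ofDifferences`, this makes centered candidates correspond bijectively
to arbitrary coefficients, which removes the constraint. -/
lemma ofDifferences_differences (hn : 1 ≤ n) (τ : Fin p → Equiv.Perm (Fin n))
    {θ : Fin p → EuclideanSpace ℝ (Fin n)} (hθ : Centered θ) :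
    ofDifferences τ (fun a => differences τ θ a.1 a.2) = θ := by
  funext j
  ext i
  have h := U_mulVec_D_mulVec hn (v := (θ j).ofLp ∘ τ j) (by
    simpa using (Equiv.sum_comp (τ j) (θ j).ofLp).trans (hθ j))
  rw [ofDifferences_apply]
  simp only [differences, P_mulVec]
  rw [h]
  simp

lemma fit_eq_sum_smul_design (hn : 1 ≤ n) (τ : Fin p → Equiv.Perm (Fin n)) (θ₀ : ℝ)
    {θ : Fin p → EuclideanSpace ℝ (Fin n)} (hθ : Centered θ) :
    fit θ₀ θ = ∑ a, coefficients τ θ₀ θ a • design τ a := by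
  rw [fit, Fintype.sum_option, Fintype.sum_prod_type, add_comm]
  congr 1
  refine Finset.sum_congr rfl fun j _ => ?_
  conv_lhs => rw [← ofDifferences_differences hn τ hθ]
  rfl

lemma objective_eq_lassoObjective (hn : 1 ≤ n) (τ : Fin p → Equiv.Perm (Fin n)) (lam : ℝ)
    (y : EuclideanSpace ℝ (Fin n)) (θ₀ : ℝ)
    {θ : Fin p → EuclideanSpace ℝ (Fin n)} (hθ : Centered θ) :
    objective τ 1 lam 0 y θ₀ θ =
      lassoObjective (design τ) (penaltyWeight n p lam) y (coefficients τ θ₀ θ) := by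
  rw [objective, lassoObjective, fit_eq_sum_smul_design hn τ θ₀ hθ,
    Fintype.sum_option (f := fun a => penaltyWeight n p lam a * |coefficients τ θ₀ θ a|),
    Fintype.sum_prod_type]
  simp [penaltyWeight, coefficients, Finset.mul_sum]

/-- Every lasso competitor is realized by a centered FLAM candidate with the same objective value.
-/
lemma IsSolution.isLassoSolution (hn : 1 ≤ n) {τ : Fin p → Equiv.Perm (Fin n)} {lam : ℝ}
    {y : EuclideanSpace ℝ (Fin n)} {θ₀ : ℝ} {θ : Fin p → EuclideanSpace ℝ (Fin n)}
    (h : IsSolution τ 1 lam 0 y θ₀ θ) :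
    IsLassoSolution (design τ) (penaltyWeight n p lam) y (coefficients τ θ₀ θ) := by
  intro c
  have hc := centered_ofDifferences hn τ fun a => c (some a)
  have h1 := h.2 (c none) _ hc
  rw [objective_eq_lassoObjective hn τ lam y _ h.1,
    objective_eq_lassoObjective hn τ lam y _ hc] at h1
  convert! h1 using 2
  funext a
  rcases a with _ | a
  · rfl
  · simp [coefficients, differences_ofDifferences]

lemma card_activeSet (τ : Fin p → Equiv.Perm (Fin n)) (θ : Fin p → EuclideanSpace ℝ (Fin n)) :
    (activeSet τ θ).card = totalKnots τ θ := by
  classical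
  have h : ∀ j, knots (τ j) (θ j) =
      (Finset.univ.filter fun k => differences τ θ j k ≠ 0 : Finset (Fin (n - 1))) := by
    intro j
    ext k
    simp [knots, differences, P_mulVec, D_mulVec, sub_eq_zero]
  simp_rw [totalKnots, h, Set.ncard_coe_finset, activeSet, Finset.card_filter]
  rw [Fintype.sum_prod_type]

/-- Columns of `V` are permuted centered columns, hence orthogonal to the nonzero intercept vector,
which can therefore be adjoined. -/
lemma linearIndepOn_design (hn : 1 ≤ n) {τ : Fin p → Equiv.Perm (Fin n)}
    {θ : Fin p → EuclideanSpace ℝ (Fin n)} (h : FullColumnRank (VA τ θ)) :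
    LinearIndepOn ℝ (design τ) (insert none (some '' (activeSet τ θ : Set _))) := by
  have h1 : LinearIndepOn ℝ (design τ) (some '' (activeSet τ θ : Set _)) := by
    have h0 : LinearIndepOn ℝ (fun a => design τ (some a)) (activeSet τ θ : Set _) :=
      h.map' (WithLp.linearEquiv 2 ℝ (Fin n → ℝ)).symm.toLinearMap (LinearEquiv.ker _)
    exact (linearIndependent_equiv' (Equiv.Set.image some _ (Option.some_injective _)) rfl).1 h0
  refine h1.insert fun hmem => ?_
  have horth : ∀ x ∈ Submodule.span ℝ (design τ '' (some '' (activeSet τ θ : Set _))),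
      ⟪x, design τ none⟫ = 0 := by
    intro x hx
    induction hx using Submodule.span_induction with
    | mem x hx =>
      obtain ⟨_, ⟨a, -, rfl⟩, rfl⟩ := hx
      simp only [design, PiLp.inner_apply, Matrix.col_apply, V_apply]
      simp
      rw [Equiv.sum_comp (τ a.1).symm fun i => U n i a.2, sum_U hn]
    | zero => simp
    | add z z' _ _ h h' => rw [inner_add_left, h, h', add_zero]
    | smul c z _ h => rw [inner_smul_left, h, mul_zero]
  have h2 := horth _ hmem
  rw [inner_self_eq_zero] at h2
  have h3 := congrArg (fun x : EuclideanSpace ℝ (Fin n) => x ⟨0, hn⟩) h2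
  simp [design] at h3

theorem finrank_span_design (hn : 1 ≤ n) {τ : Fin p → Equiv.Perm (Fin n)}
    {θ : Fin p → EuclideanSpace ℝ (Fin n)} (h : FullColumnRank (VA τ θ)) :
    Module.finrank ℝ (Submodule.span ℝ
      (design τ '' insert none (some '' (activeSet τ θ : Set _)))) = 1 + totalKnots τ θ := by
  classical
  have h1 := finrank_span_eq_card (linearIndepOn_design hn h)
  rw [← Set.image_eq_range] at h1
  rw [h1, ← card_activeSet, ← Nat.card_eq_fintype_card, Nat.card_coe_set_eq,
    Set.ncard_insert_of_notMem (by simp), Set.ncard_image_of_injective _ (Option.some_injective _),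
    Set.ncard_coe_finset, add_comm]

/-- Full column rank makes the Gram matrix invertible, and cyclicity of the trace leaves the
identity on the active set. -/
theorem dfHat_eq (τ : Fin p → Equiv.Perm (Fin n)) (lam : ℝ)
    {θ : Fin p → EuclideanSpace ℝ (Fin n)} (h : FullColumnRank (VA τ θ)) :
    dfHat τ 1 lam 0 θ = 1 + (totalKnots τ θ : ℝ) := by
  have hdet : IsUnit ((VA τ θ)ᵀ * VA τ θ).det := by
    rw [← Matrix.isUnit_iff_isUnit_det]
    have hinj : Function.Injective (VA τ θ).mulVec := Matrix.mulVec_injective_iff.2 h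
    have := Matrix.PosDef.conjTranspose_mul_self (VA τ θ) hinj
    rw [Matrix.conjTranspose_eq_transpose_of_trivial] at this
    exact this.isUnit
  rw [dfHat, sub_self, zero_mul, zero_smul, zero_smul, add_zero, add_zero, Matrix.mul_assoc,
    Matrix.trace_mul_comm, Matrix.mul_assoc, Matrix.nonsing_inv_mul _ hdet, Matrix.trace_one,
    Fintype.card_coe, card_activeSet, add_comm]

/-- The FLAM fit extends to a Lipschitz function of the response whose divergence is almost
everywhere one plus the number of knots of every solution with `V_𝒜` of full column rank. -/
theorem exists_lipschitzWith_fit (hn : 1 ≤ n) (τ : Fin p → Equiv.Perm (Fin n)) {lam : ℝ}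
    (hlam : 0 ≤ lam) :
    ∃ (F : EuclideanSpace ℝ (Fin n) → EuclideanSpace ℝ (Fin n)) (C : ℝ≥0), LipschitzWith C F ∧
      (∀ y θ₀ θ, IsSolution τ 1 lam 0 y θ₀ θ → F y = fit θ₀ θ) ∧
      ∀ᵐ y, ∀ θ₀ θ, IsSolution τ 1 lam 0 y θ₀ θ → FullColumnRank (VA τ θ) →
        ∑ i, lineDeriv ℝ (fun x => F x i) y (EuclideanSpace.single i 1) =
          1 + (totalKnots τ θ : ℝ) := by
  have hw : ∀ a, 0 ≤ penaltyWeight n p lam a := by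
    rintro (_ | a)
    exacts [le_rfl, hlam]
  obtain ⟨F, C, hF, hfit, hae⟩ := exists_lipschitzWith_lasso_fit (design τ) hw
  refine ⟨F, C, hF, fun y θ₀ θ h => ?_, ?_⟩
  · rw [hfit y _ (h.isLassoSolution hn), fit_eq_sum_smul_design hn τ θ₀ h.1]
  filter_upwards [hae, hF.ae_differentiableAt] with y hy hd θ₀ θ h hr
  -- The intercept is always included: its weight is 0, so stationarity holds even when `θ₀ = 0`.
  have h1 := hy _ (insert none (some '' (activeSet τ θ : Set _))) (h.isLassoSolution hn) (by
      rintro (_ | a) ha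
      · simp
      · simpa [activeSet, coefficients] using ha) (by
      rintro (_ | a) ha
      · exact Or.inr rfl
      · exact Or.inl (by simpa [activeSet, coefficients] using ha))
  set W := Submodule.span ℝ (design τ '' insert none (some '' (activeSet τ θ : Set _))) with hW
  have h2 : ∀ i, lineDeriv ℝ (fun x => F x i) y (EuclideanSpace.single i 1) =
      W.starProjection (EuclideanSpace.single i 1) i := fun i => by
    rw [← h1]
    exact (((EuclideanSpace.proj (𝕜 := ℝ) i).hasFDerivAt.comp y
      hd.hasFDerivAt).hasLineDerivAt _).lineDeriv
  have h3 : LinearMap.IsProj W (W.starProjection : _ →ₗ[ℝ] EuclideanSpace ℝ (Fin n)) :=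
    ⟨fun x => Submodule.starProjection_apply_mem W x,
      fun x hx => Submodule.starProjection_eq_self_iff.2 hx⟩
  -- The trace is the rank, and in the standard basis it is the divergence.
  have h4 := h3.trace
  rw [LinearMap.trace_eq_sum_inner _ (EuclideanSpace.basisFun (Fin n) ℝ),
    finrank_span_design hn hr] at h4
  simp_rw [h2]
  push_cast at h4
  rw [← h4]
  refine Finset.sum_congr rfl fun i _ => ?_
  rw [EuclideanSpace.basisFun_apply, EuclideanSpace.inner_single_left]
  simp

/-- The degrees of freedom of FLAM are the mean of one plus the total number of knots. -/
theorem degreesOfFreedom_eq (hn : 1 ≤ n) (τ : Fin p → Equiv.Perm (Fin n)) {lam : ℝ}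
    (hlam : 0 ≤ lam) {Ω : Type*} [MeasurableSpace Ω] (Pr : Measure Ω) [IsProbabilityMeasure Pr]
    (μ : EuclideanSpace ℝ (Fin n)) {σ : ℝ} (hσ : 0 < σ) (Y : Ω → EuclideanSpace ℝ (Fin n))
    (hY : HasLaw Y (multivariateGaussian μ (σ ^ 2 • (1 : Matrix (Fin n) (Fin n) ℝ))) Pr)
    (θ₀ : Ω → ℝ) (θ : Ω → Fin p → EuclideanSpace ℝ (Fin n))
    (hsol : ∀ᵐ ω ∂Pr, IsSolution τ 1 lam 0 (Y ω) (θ₀ ω) (θ ω))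
    (hrank : ∀ᵐ ω ∂Pr, FullColumnRank (VA τ (θ ω))) :
    (∀ i, MemLp (fun ω => fit (θ₀ ω) (θ ω) i) 2 Pr) ∧
      Integrable (fun ω => (totalKnots τ (θ ω) : ℝ)) Pr ∧
      degreesOfFreedom Pr σ Y (fun ω => fit (θ₀ ω) (θ ω)) =
        ∫ ω, (1 + (totalKnots τ (θ ω) : ℝ)) ∂Pr := by
  obtain ⟨F, C, hF, hfit, hdiv⟩ := exists_lipschitzWith_fit hn τ hlam
  have hFi : ∀ i, LipschitzWith C fun x => F x i := fun i =>
    LipschitzWith.of_dist_le_mul fun x y => by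
      have h := hF.dist_le_mul x y
      rw [dist_eq_norm (F x)] at h
      rw [Real.dist_eq]
      exact (PiLp.norm_apply_le (F x - F y) i).trans h
  have hfit' : ∀ᵐ ω ∂Pr, fit (θ₀ ω) (θ ω) = F (Y ω) := by
    filter_upwards [hsol] with ω h using (hfit _ _ _ h).symm
  have hdiv' : ∀ᵐ ω ∂Pr,
      ∑ i, lineDeriv ℝ (fun x => F x i) (Y ω) (EuclideanSpace.single i 1) =
        1 + (totalKnots τ (θ ω) : ℝ) := by
    -- The divergence formula holds off a Lebesgue-null set, which is also null for the law of `Y`.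
    have h := (multivariateGaussian_sq_smul_one_absolutelyContinuous μ hσ).ae_le hdiv
    rw [← hY.map_eq] at h
    filter_upwards [ae_of_ae_map hY.aemeasurable h, hsol, hrank] with ω h1 h2 h3
      using h1 _ _ h2 h3
  have hstein := fun i => (hFi i).covariance_multivariateGaussian μ hσ i
  have hdivint : Integrable
      (fun y => ∑ i, lineDeriv ℝ (fun x => F x i) y (EuclideanSpace.single i 1))
      (multivariateGaussian μ (σ ^ 2 • (1 : Matrix (Fin n) (Fin n) ℝ))) :=
    integrable_finsetSum _ fun i _ => (hstein i).1
  -- Measurability of the knot count comes from its almost sure equality with the divergence at `Y`.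
  have hknots : Integrable (fun ω => 1 + (totalKnots τ (θ ω) : ℝ)) Pr := by
    rw [← hY.map_eq] at hdivint
    exact (hdivint.comp_aemeasurable hY.aemeasurable).congr hdiv'
  refine ⟨fun i => ?_, ?_, ?_⟩
  · have h := (hFi i).memLp_two_multivariateGaussian μ (σ ^ 2 • (1 : Matrix (Fin n) (Fin n) ℝ))
    rw [← hY.map_eq] at h
    refine (h.comp_of_map hY.aemeasurable).ae_eq ?_
    filter_upwards [hfit'] with ω h
    simp [h]
  · exact (hknots.sub (integrable_const 1)).congr (Eventually.of_forall fun ω => by simp)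
  · have hcov : ∀ i, cov[fun ω => Y ω i, fun ω => fit (θ₀ ω) (θ ω) i; Pr] =
        σ ^ 2 * ∫ y, lineDeriv ℝ (fun x => F x i) y (EuclideanSpace.single i 1)
          ∂(multivariateGaussian μ (σ ^ 2 • (1 : Matrix (Fin n) (Fin n) ℝ))) := fun i => by
      rw [← (hstein i).2, ← hY.covariance_fun_comp (f := fun x => x i) (g := fun x => F x i)
        (by fun_prop) (hFi i).continuous.aemeasurable]
      have he : (fun ω => fit (θ₀ ω) (θ ω) i) =ᵐ[Pr] fun ω => F (Y ω) i := by
        filter_upwards [hfit'] with ω h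
        rw [h]
      rw [covariance, covariance, integral_congr_ae he]
      refine integral_congr_ae ?_
      filter_upwards [he] with ω h
      rw [h]
    rw [degreesOfFreedom]
    simp_rw [hcov]
    rw [← Finset.mul_sum, ← integral_finsetSum _ fun i _ => (hstein i).1, ← mul_assoc,
      one_div_mul_cancel (by positivity), one_mul, ← integral_congr_ae hdiv']
    exact (hY.integral_comp hdivint.aestronglyMeasurable).symm

end FLAM

end

theorem corollary2 {n p : ℕ} (hn : 1 ≤ n)
    (X : Matrix (Fin n) (Fin p) ℝ) (τ : Fin p → Equiv.Perm (Fin n))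
    (hτ : ∀ j, FLAM.Orders (fun i => X i j) (τ j))
    (lam : ℝ) (hlam : 0 ≤ lam) :
    -- the estimator of the degrees of freedom is one plus the total number of knots
    (∀ (y : EuclideanSpace ℝ (Fin n)) (θ₀ : ℝ) (θ : Fin p → EuclideanSpace ℝ (Fin n)),
      FLAM.IsSolution τ 1 lam 0 y θ₀ θ → FLAM.FullColumnRank (FLAM.VA τ θ) →
        FLAM.dfHat τ 1 lam 0 θ = 1 + (FLAM.totalKnots τ θ : ℝ)) ∧
    -- the degrees of freedom are the mean of one plus the total number of knots
    (∀ {Ω : Type*} [MeasurableSpace Ω] (Pr : Measure Ω) [IsProbabilityMeasure Pr]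
      (μ : EuclideanSpace ℝ (Fin n)) (σ : ℝ) (_ : 0 < σ)
      (Y : Ω → EuclideanSpace ℝ (Fin n))
      (_ : HasLaw Y (multivariateGaussian μ (σ ^ 2 • (1 : Matrix (Fin n) (Fin n) ℝ))) Pr)
      (θ₀ : Ω → ℝ) (θ : Ω → Fin p → EuclideanSpace ℝ (Fin n))
      (_ : ∀ᵐ ω ∂Pr, FLAM.IsSolution τ 1 lam 0 (Y ω) (θ₀ ω) (θ ω))
      (_ : ∀ᵐ ω ∂Pr, FLAM.FullColumnRank (FLAM.VA τ (θ ω))),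
      (∀ i, MemLp (fun ω => FLAM.fit (θ₀ ω) (θ ω) i) 2 Pr) ∧
      Integrable (fun ω => (FLAM.totalKnots τ (θ ω) : ℝ)) Pr ∧
      FLAM.degreesOfFreedom Pr σ Y (fun ω => FLAM.fit (θ₀ ω) (θ ω)) =
        ∫ ω, (1 + (FLAM.totalKnots τ (θ ω) : ℝ)) ∂Pr) := by
  refine ⟨fun y θ₀ θ _ h => FLAM.dfHat_eq τ lam h, ?_⟩
  intro Ω _ Pr _ μ σ hσ Y hY θ₀ θ hsol hrank
  exact FLAM.degreesOfFreedom_eq hn τ hlam Pr μ hσ Y hY θ₀ θ hsol hrank
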